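/- Let $\mathcal S$ and $\mathcal T$ be monoidal categories that are abelian and whose tensor products $X\otimes -$ and $-\otimes X$ preserve coequalizers (equivalently, cokernels, when the tensor product is additive in each variable) for every object $X$. For an algebra (monoid object) $A$ in a monoidal category $\mathcal C$, let $\mathcal C_A$ be the category of right $A$-modules in $\mathcal C$; it is a left $\mathcal C$-module category, where $X\in\mathcal C$ acts by $(M,\rho_M)\mapsto X\otimes M$ with action $(X\otimes M)\otimes A\cong X\otimes(M\otimes A)\xrightarrow{\mathrm{id}_X\otimes\rho_M}X\otimes M$. Two algebras $A,B$ in $\mathcal C$ are called Morita equivalent if $\mathcal C_A$ and $\mathcal C_B$ are equivalent as left $\mathcal C$-module categories, that is, if there is a functor $F:\mathcal C_A\to\mathcal C_B$ that is an equivalence of categories and carries natural isomorphisms $F(X\otimes M)\cong X\otimes F(M)$ compatible with the associativity and unit isomorphisms. Let $(\Gamma,\Gamma_{*,*},\Gamma_0):\mathcal S\to\mathcal T$ be a (lax) monoidal functor such that $\Gamma$ preserves epimorphisms and every structure morphism $\Gamma_{X,Y}:\Gamma(X)\otimes\Gamma(Y)\to\Gamma(X\otimes Y)$ is an epimorphism.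 If $S$ and $S'$ are Morita equivalent algebras in $\mathcal S$, then $\Gamma(S)$ and $\Gamma(S')$, with multiplication $\Gamma(m)\,\Gamma_{S,S}$ and unit $\Gamma(u)\,\Gamma_0$ (respectively with $S'$ in place of $S$), are Morita equivalent algebras in $\mathcal T$. -/

import Mathlib

open CategoryTheory MonoidalCategory

namespace MoritaMonoidal

universe v u

variable {C : Type u} [Category.{v} C] [MonoidalCategory C]

/-- A right module `(M, ρ_M : M ⊗ A ⟶ M)` over an algebra (monoid object) `A` of a monoidal
category `C`. -/
structure RightMod (A : Mon C) where
  /-- The underlying object of `C`. -/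
  X : C
  /-- The right action of `A`. -/
  act : X ⊗ A.X ⟶ X
  act_one : X ◁ MonObj.one (X := A.X) ≫ act = (ρ_ X).hom
  act_mul : act ▷ A.X ≫ act = (α_ X A.X A.X).hom ≫ X ◁ MonObj.mul (X := A.X) ≫ act

namespace RightMod

variable {A : Mon C}

/-- A morphism of right `A`-modules: a morphism of `C` that commutes with the actions. -/
@[ext]
structure Hom (M N : RightMod A) where
  /-- The underlying morphism of `C`. -/
  hom : M.X ⟶ N.X
  act_hom : M.act ≫ hom = hom ▷ A.X ≫ N.act

/-- The category `C_A` of right `A`-modules in `C`. -/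
instance : Category (RightMod A) where
  Hom M N := Hom M N
  id M := { hom := 𝟙 M.X, act_hom := by simp }
  comp f g :=
    { hom := f.hom ≫ g.hom
      act_hom := by
        rw [← Category.assoc, f.act_hom, Category.assoc, g.act_hom, comp_whiskerRight,
          Category.assoc] }

@[ext]
theorem hom_ext {M N : RightMod A} (f g : M ⟶ N) (h : f.hom = g.hom) : f = g :=
  Hom.ext h

@[simp]
theorem id_hom (M : RightMod A) : Hom.hom (𝟙 M) = 𝟙 M.X := rfl

@[simp]
theorem comp_hom {M N K : RightMod A} (f : M ⟶ N) (g : N ⟶ K) :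
    (f ≫ g).hom = f.hom ≫ g.hom := rfl

/-- An isomorphism in `C` commuting with the actions is an isomorphism of right `A`-modules. -/
def mkIso {M N : RightMod A} (e : M.X ≅ N.X) (h : M.act ≫ e.hom = e.hom ▷ A.X ≫ N.act) :
    M ≅ N where
  hom := { hom := e.hom, act_hom := h }
  inv :=
    { hom := e.inv
      act_hom := by
        rw [Iso.comp_inv_eq, Category.assoc, h, ← comp_whiskerRight_assoc, e.inv_hom_id,
          id_whiskerRight, Category.id_comp] }
  hom_inv_id := by apply hom_ext; exact e.hom_inv_id
  inv_hom_id := by apply hom_ext; exact e.inv_hom_id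

@[simp]
theorem mkIso_hom_hom {M N : RightMod A} (e : M.X ≅ N.X)
    (h : M.act ≫ e.hom = e.hom ▷ A.X ≫ N.act) : (mkIso e h).hom.hom = e.hom := rfl

@[simp]
theorem mkIso_inv_hom {M N : RightMod A} (e : M.X ≅ N.X)
    (h : M.act ≫ e.hom = e.hom ▷ A.X ≫ N.act) : (mkIso e h).inv.hom = e.inv := rfl

/-- For `Y` in `C` and a right `A`-module `M`, the right `A`-module `Y ⊗ M`, with action
`(Y ⊗ M) ⊗ A ≅ Y ⊗ (M ⊗ A) ⟶ Y ⊗ M`. -/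
abbrev tensorObj (Y : C) (M : RightMod A) : RightMod A where
  X := Y ⊗ M.X
  act := (α_ Y M.X A.X).hom ≫ Y ◁ M.act
  act_one := by
    simp [← whiskerLeft_comp, M.act_one]
  act_mul := by
    have h := congrArg (fun f => Y ◁ f) M.act_mul
    simp only [whiskerLeft_comp] at h
    simp [h]

/-- The category `C_A` is a left `C`-module category, with action `Y ⊗ (M, ρ_M) = Y ⊗ M`; the
action on morphisms, the associativity isomorphisms and the unit isomorphisms are those of `C`. -/
instance : MonoidalLeftAction C (RightMod A) where
  actionObj Y M := tensorObj Y M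
  actionHomLeft f M :=
    { hom := f ▷ M.X
      act_hom := by simp [whisker_exchange] }
  actionHomRight Y _ _ g :=
    { hom := Y ◁ g.hom
      act_hom := by
        have h := congrArg (fun f => Y ◁ f) g.act_hom
        simp only [whiskerLeft_comp] at h
        simp [h] }
  actionAssocIso Y Z M := mkIso (α_ Y Z M.X) (by simp)
  actionUnitIso M := mkIso (λ_ M.X) (by simp)
  actionHom_comp f₁ f₂ g₁ g₂ := by
    apply hom_ext
    simp [whisker_exchange_assoc]
  actionAssocIso_hom_naturality f g h := by
    apply hom_ext
    simp [MonoidalCategory.tensorHom_def]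
  actionUnitIso_hom_naturality f := by
    apply hom_ext
    simp

end RightMod

/-- Two algebras `A` and `B` in a monoidal category `C` are Morita equivalent if there is an
equivalence of left `C`-module categories between `C_A` and `C_B`: a functor `F : C_A ⥤ C_B` that
is an equivalence of categories, equipped with a coherent natural isomorphism
`F (Y ⊗ M) ≅ Y ⊗ F M`. -/
def MoritaEquivalent (A B : Mon C) : Prop :=
  ∃ F : RightMod A ⥤ RightMod B, F.IsEquivalence ∧ Nonempty (F.LeftLinear C)

end MoritaMonoidal

/-! A lax monoidal functor need not carry equivalences of module categories to such equivalences,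
but it does transport enriched categories. So Morita equivalence is encoded by an enriched category
with two objects, as in a Morita context with surjective pairings.

From an equivalence `C_A ≃ C_B`, write `D = C_A` with its two left-linear equivalences `F i` to
modules, and let `gen (F i)` correspond to the regular module. Then `(F j).obj M` acts as an
internal hom from `gen (F j)` to `M`, so these objects yield an enriched category whose endomorphism
algebras are `A` and `B`. Its compositions are epimorphisms because every module is a regular
quotient of a free one (`isRegularEpi_actHom`), equivalences preserve this, and regular epimorphisms
of modules are epimorphisms in `C` (`epi_hom_of_isRegularEpi`).

Conversely, if the compositions through `i` that return to their source are epimorphisms, evaluation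
at `i` is an equivalence from modules over the enriched category to modules over the endomorphism
algebra of `i` (`eval_isEquivalence`). Doing this at both objects gives `moritaEquivalent_endMon`.

The transported compositions are `μ ≫ Γ.map (eComp ..)`, epimorphisms by the hypotheses on `Γ`. -/

namespace MoritaMonoidal

/-! ### Left-linear functors: composites and quasi-inverses -/

section LinearFunctors

open MonoidalLeftAction Functor.LaxLeftLinear Functor.OplaxLeftLinear

variable {C D D' D'' : Type*} [Category* C] [MonoidalCategory C]
  [Category* D] [Category* D'] [Category* D'']
  [MonoidalLeftAction C D] [MonoidalLeftAction C D'] [MonoidalLeftAction C D'']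

/-- A left-linear structure from a coherent natural family of isomorphisms
`c ⊙ₗ F d ≅ F (c ⊙ₗ d)`. -/
@[reducible]
def leftLinearOfIso (F : D ⥤ D') (m : ∀ (c : C) (d : D), c ⊙ₗ F.obj d ≅ F.obj (c ⊙ₗ d))
    (naturality_left : ∀ {c c' : C} (f : c ⟶ c') (d : D),
      f ⊵ₗ F.obj d ≫ (m c' d).hom = (m c d).hom ≫ F.map (f ⊵ₗ d))
    (naturality_right : ∀ (c : C) {d d' : D} (f : d ⟶ d'),
      c ⊴ₗ F.map f ≫ (m c d').hom = (m c d).hom ≫ F.map (c ⊴ₗ f))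
    (associativity : ∀ (c c' : C) (d : D),
      (m (c ⊗ c') d).hom ≫ F.map (αₗ _ _ _).hom =
        (αₗ c c' (F.obj d)).hom ≫ c ⊴ₗ (m c' d).hom ≫ (m c (c' ⊙ₗ d)).hom)
    (unitality : ∀ d : D,
      (λₗ (F.obj d)).hom = (m (𝟙_ C) d).hom ≫ F.map (λₗ d).hom) : F.LeftLinear C where
  μₗ c d := (m c d).hom
  μₗ_naturality_left := naturality_left
  μₗ_naturality_right := naturality_right
  μₗ_associativity := associativity
  μₗ_unitality := unitality
  δₗ c d := (m c d).inv
  δₗ_naturality_left f d := by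
    rw [← cancel_epi (m _ d).hom, ← reassoc_of% (naturality_left f d)]
    simp
  δₗ_naturality_right c _ _ f := by
    rw [← cancel_epi (m c _).hom, ← reassoc_of% (naturality_right c f)]
    simp
  δₗ_associativity c c' d := by
    rw [← cancel_epi (m _ d).hom, reassoc_of% (associativity c c' d)]
    simp
  δₗ_unitality_inv d := by
    rw [← cancel_epi (λₗ[C] (F.obj d)).hom, Iso.hom_inv_id, unitality]
    simp [← F.map_comp_assoc]
  μₗ_comp_δₗ _ _ := by simp
  δₗ_comp_μₗ _ _ := by simp

/-- The identity functor is left-linear. -/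
@[reducible]
def leftLinearId : (𝟭 D).LeftLinear C :=
  leftLinearOfIso (𝟭 D) (fun c d ↦ Iso.refl (c ⊙ₗ d)) (by simp) (by simp)
    (by simp) (by simp)

/-- The composition of two left-linear functors is left-linear. -/
@[reducible]
def leftLinearComp (F : D ⥤ D') (G : D' ⥤ D'') [F.LeftLinear C] [G.LeftLinear C] :
    (F ⋙ G).LeftLinear C :=
  leftLinearOfIso (F ⋙ G)
    (fun c d ↦ Functor.LeftLinear.μₗIso G c (F.obj d) ≪≫
      G.mapIso (Functor.LeftLinear.μₗIso F c d))
    (fun f d ↦ by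
      simp only [Functor.comp_obj, Functor.comp_map, Iso.trans_hom, Functor.mapIso_hom,
        Category.assoc, ← G.map_comp, ← μₗ_naturality_left, μₗ_naturality_left_assoc])
    (fun c _ _ f ↦ by
      simp only [Functor.comp_obj, Functor.comp_map, Iso.trans_hom, Functor.mapIso_hom,
        Category.assoc, ← G.map_comp, ← μₗ_naturality_right, μₗ_naturality_right_assoc])
    (fun c c' d ↦ by
      simp only [Functor.comp_obj, Functor.comp_map, Iso.trans_hom, Functor.mapIso_hom,
        Category.assoc, ← G.map_comp, μₗ_associativity, actionHomRight_comp]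
      simp only [G.map_comp, μₗ_associativity_assoc, μₗ_naturality_right_assoc])
    (fun d ↦ by
      simp only [Functor.comp_obj, Functor.comp_map, Iso.trans_hom, Functor.mapIso_hom,
        Category.assoc, ← G.map_comp, ← μₗ_unitality])

/-- A section, up to isomorphism, of a fully faithful left-linear functor is left-linear. -/
@[reducible]
noncomputable def leftLinearOfSection (F : D ⥤ D') [F.Full] [F.Faithful] [F.LeftLinear C]
    (G : D' ⥤ D) (e : ∀ d, F.obj (G.obj d) ≅ d)
    (he : ∀ {d d' : D'} (f : d ⟶ d'), F.map (G.map f) = (e d).hom ≫ f ≫ (e d').inv) :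
    G.LeftLinear C :=
  -- After applying `F`, this is `F (c ⊙ₗ G d) ≅ c ⊙ₗ F (G d) ≅ c ⊙ₗ d ≅ F (G (c ⊙ₗ d))`; coherence
  -- can be tested there since `F` is faithful.
  leftLinearOfIso G (fun c d ↦ F.preimageIso
      ((Functor.LeftLinear.μₗIso F c (G.obj d)).symm ≪≫
        { hom := c ⊴ₗ (e d).hom
          inv := c ⊴ₗ (e d).inv
          hom_inv_id := by simp
          inv_hom_id := by simp } ≪≫ (e (c ⊙ₗ d)).symm))
    (fun {c c'} f d ↦ by
      apply F.map_injective
      simp only [F.map_comp, Functor.preimageIso_hom, F.map_preimage, Iso.trans_hom, Iso.symm_hom,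
        he, δₗ_naturality_left_assoc, Category.assoc, Iso.inv_hom_id_assoc, action_exchange_assoc])
    (fun c d d' f ↦ by
      apply F.map_injective
      simp only [F.map_comp, Functor.preimageIso_hom, F.map_preimage, Iso.trans_hom, Iso.symm_hom,
        he, δₗ_naturality_right_assoc, Category.assoc, Iso.inv_hom_id_assoc, actionHomRight_comp,
        actionHomRight_inv_hom_assoc])
    (fun c c' d ↦ by
      apply F.map_injective
      simp only [F.map_comp, Functor.preimageIso_hom, F.map_preimage, Iso.trans_hom, Iso.symm_hom,
        he, δₗ_naturality_right_assoc, Category.assoc, Iso.inv_hom_id_assoc, actionHomRight_comp,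
        actionHomRight_inv_hom_assoc, tensor_actionHomRight, Iso.inv_hom_id_assoc,
        δₗ_associativity_assoc])
    (fun d ↦ by
      apply F.map_injective
      simp only [F.map_comp, Functor.preimageIso_hom, F.map_preimage, Iso.trans_hom, Iso.symm_hom,
        he, Category.assoc, Iso.inv_hom_id_assoc, unit_actionHomRight,
        δₗ_unitality_hom_assoc, Iso.hom_inv_id, Category.comp_id])

/-- The quasi-inverse of a left-linear equivalence is left-linear. -/
@[reducible]
noncomputable def leftLinearInv (F : D ⥤ D') [F.IsEquivalence] [F.LeftLinear C] :
    F.inv.LeftLinear C :=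
  leftLinearOfSection F F.inv (fun d ↦ F.asEquivalence.counitIso.app d)
    (fun f ↦ by
      exact (NatIso.naturality_2 F.asEquivalence.counitIso f).symm)

end LinearFunctors

namespace MoritaEquivalent

universe v u
variable {C : Type u} [Category.{v} C] [MonoidalCategory C] {A B K : Mon C}

theorem symm (h : MoritaEquivalent A B) : MoritaEquivalent B A := by
  obtain ⟨F, _, ⟨_⟩⟩ := h
  exact ⟨F.inv, inferInstance, ⟨leftLinearInv F⟩⟩

theorem trans (h : MoritaEquivalent A B) (h' : MoritaEquivalent B K) : MoritaEquivalent A K := by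
  obtain ⟨F, _, ⟨_⟩⟩ := h
  obtain ⟨G, _, ⟨_⟩⟩ := h'
  exact ⟨F ⋙ G, inferInstance, ⟨leftLinearComp F G⟩⟩

end MoritaEquivalent

/-! ### Restriction of scalars and isomorphic algebras -/

namespace RightMod

universe v u
variable {C : Type u} [Category.{v} C] [MonoidalCategory C] {A B : Mon C}

open MonoidalLeftAction

/-- The forgetful functor from right `A`-modules to `C`. -/
@[simps]
def forget (A : Mon C) : RightMod A ⥤ C where
  obj M := M.X
  map f := f.hom

/-- Restriction of scalars along a morphism of algebras, on objects. -/
abbrev restrictObj (f : A ⟶ B) (M : RightMod B) : RightMod A where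
  X := M.X
  act := M.X ◁ f.hom ≫ M.act
  act_one := by
    rw [← whiskerLeft_comp_assoc, IsMonHom.one_hom]
    exact M.act_one
  act_mul := by
    rw [← whiskerLeft_comp_assoc, IsMonHom.mul_hom, comp_whiskerRight, Category.assoc,
      ← whisker_exchange_assoc, M.act_mul]
    simp [MonoidalCategory.tensorHom_def]

/-- Restriction of scalars along a morphism of algebras. -/
def restrict (f : A ⟶ B) : RightMod B ⥤ RightMod A where
  obj M := restrictObj f M
  map g :=
    { hom := g.hom
      act_hom := by rw [Category.assoc, g.act_hom, whisker_exchange_assoc] }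

/-- Restriction of scalars is left-linear. -/
@[reducible]
def leftLinearRestrict (f : A ⟶ B) : (restrict f).LeftLinear C :=
  leftLinearOfIso _ (fun Y M ↦ mkIso (Iso.refl (Y ⊗ M.X)) (by
      change ((α_ Y M.X A.X).hom ≫ Y ◁ (M.X ◁ f.hom ≫ M.act)) ≫ 𝟙 (Y ⊗ M.X) = 𝟙 (Y ⊗ M.X) ▷ A.X ≫
        ((Y ⊗ M.X) ◁ f.hom ≫ (α_ Y M.X B.X).hom ≫ Y ◁ M.act)
      simp))
    (fun {Y Z} g M ↦ by
      apply hom_ext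
      change g ▷ M.X ≫ 𝟙 (Z ⊗ M.X) = 𝟙 (Y ⊗ M.X) ≫ g ▷ M.X
      simp)
    (fun Y M N g ↦ by
      apply hom_ext
      change Y ◁ g.hom ≫ 𝟙 (Y ⊗ N.X) = 𝟙 (Y ⊗ M.X) ≫ Y ◁ g.hom
      simp)
    (fun Y Z M ↦ by
      apply hom_ext
      change 𝟙 ((Y ⊗ Z) ⊗ M.X) ≫ (α_ Y Z M.X).hom =
        (α_ Y Z M.X).hom ≫ Y ◁ 𝟙 (Z ⊗ M.X) ≫ 𝟙 (Y ⊗ Z ⊗ M.X)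
      simp)
    (fun M ↦ by
      apply hom_ext
      change (λ_ M.X).hom = 𝟙 (𝟙_ C ⊗ M.X) ≫ (λ_ M.X).hom
      simp)

instance restrict_isEquivalence (f : A ⟶ B) [IsIso f] : (restrict f).IsEquivalence where
  faithful := ⟨fun {M N g g'} h ↦ by
    apply hom_ext
    exact congrArg (fun k : restrictObj f M ⟶ restrictObj f N ↦ Hom.hom k) h⟩
  full := ⟨fun {M N} g ↦ ⟨{
    hom := g.hom
    act_hom := by
      have : IsIso f.hom := inferInstanceAs (IsIso ((Mon.forget C).map f))
      have key (k : M.X ⟶ N.X) (h : (M.X ◁ f.hom ≫ M.act) ≫ k = k ▷ A.X ≫ N.X ◁ f.hom ≫ N.act) :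
          M.act ≫ k = k ▷ B.X ≫ N.act := by
        rw [← whisker_exchange_assoc, Category.assoc] at h
        exact (cancel_epi (M.X ◁ f.hom)).1 h
      exact key g.hom g.act_hom }, rfl⟩⟩
  essSurj := ⟨fun M ↦ ⟨restrictObj (inv f) M, ⟨mkIso (Iso.refl M.X) (by
    have h : f.hom ≫ (inv f).hom = 𝟙 _ := by
      rw [← Mon.comp_hom', IsIso.hom_inv_id, Mon.id_hom']
    change (M.X ◁ f.hom ≫ M.X ◁ (inv f).hom ≫ M.act) ≫ 𝟙 M.X = 𝟙 M.X ▷ A.X ≫ M.act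
    simp [← whiskerLeft_comp_assoc, h])⟩⟩⟩

end RightMod

theorem MoritaEquivalent.of_iso {C : Type*} [Category* C] [MonoidalCategory C] {A B : Mon C}
    (e : A ≅ B) : MoritaEquivalent A B :=
  ⟨RightMod.restrict e.inv, inferInstance, ⟨RightMod.leftLinearRestrict e.inv⟩⟩

end MoritaMonoidal
namespace MoritaMonoidal

/-! ### Coequalizers, epimorphisms and tensoring -/

section Coequalizers

open Limits

universe v u v' u'

theorem epi_map_of_isRegularEpi {C : Type u} [Category.{v} C] {D : Type u'} [Category.{v'} D]
    (F : C ⥤ D) [PreservesColimitsOfShape WalkingParallelPair F] {X Y : C} (f : X ⟶ Y)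
    [IsRegularEpi f] : Epi (F.map f) :=
  epi_of_isColimit_cofork (isColimitCoforkMapOfIsColimit F _ (IsRegularEpi.isColimit f))

theorem exists_desc_of_epi {C : Type u} [Category.{v} C] [IsRegularEpiCategory C] {X Y Z : C}
    (f : X ⟶ Y) [Epi f] (k : X ⟶ Z)
    (h : ∀ {W : C} (a b : W ⟶ X), a ≫ f = b ≫ f → a ≫ k = b ≫ k) : ∃ l, f ≫ l = k :=
  have := IsRegularEpiCategory.regularEpiOfEpi f
  ⟨IsRegularEpi.desc f k (h _ _ (IsRegularEpi.w f)), IsRegularEpi.fac ..⟩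

variable {V : Type u} [Category.{v} V] [MonoidalCategory V]

theorem epi_whiskerRight_of_isRegularEpi (Y : V)
    [PreservesColimitsOfShape WalkingParallelPair (tensorRight Y)]
    {X Z : V} (f : X ⟶ Z) [IsRegularEpi f] : Epi (f ▷ Y) :=
  epi_map_of_isRegularEpi (tensorRight Y) f

theorem epi_whiskerRight [IsRegularEpiCategory V] (Y : V)
    [PreservesColimitsOfShape WalkingParallelPair (tensorRight Y)]
    {X Z : V} (f : X ⟶ Z) [Epi f] : Epi (f ▷ Y) :=
  have := IsRegularEpiCategory.regularEpiOfEpi f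
  epi_whiskerRight_of_isRegularEpi Y f

theorem epi_whiskerLeft [IsRegularEpiCategory V] (Y : V)
    [PreservesColimitsOfShape WalkingParallelPair (tensorLeft Y)]
    {X Z : V} (f : X ⟶ Z) [Epi f] : Epi (Y ◁ f) :=
  have := IsRegularEpiCategory.regularEpiOfEpi f
  epi_map_of_isRegularEpi (tensorLeft Y) f

/-- The universal property of a coequalizer survives `- ⊗ Y`; this is what puts actions on
coequalizers. -/
theorem exists_desc_whiskerRight [HasCoequalizers V] (Y : V)
    [PreservesColimitsOfShape WalkingParallelPair (tensorRight Y)]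
    {W X Z : V} (a b : W ⟶ X) (k : X ⊗ Y ⟶ Z) (h : a ▷ Y ≫ k = b ▷ Y ≫ k) :
    ∃ l, coequalizer.π a b ▷ Y ≫ l = k := by
  have hc := isColimitCoforkMapOfIsColimit (tensorRight Y) _ (coequalizerIsCoequalizer a b)
  exact ⟨Cofork.IsColimit.desc hc k h, Cofork.IsColimit.π_desc' hc k h⟩

end Coequalizers

-- Modules over an enriched category

universe w v u

/-- The endomorphism algebra of an object of an enriched category. -/
abbrev endMon (V : Type u) [Category.{v} V] [MonoidalCategory V] {ι : Type w} [EnrichedCategory V ι]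
    (i : ι) : Mon V where
  X := i ⟶[V] i
  mon :=
    { one := eId V i
      mul := eComp V i i i
      one_mul := by rw [← cancel_epi (λ_ _).inv, e_id_comp, Iso.inv_hom_id]
      mul_one := by rw [← cancel_epi (ρ_ _).inv, e_comp_id, Iso.inv_hom_id]
      mul_assoc := (e_assoc' V i i i i).symm }

/-- A module over a category enriched in `V`: a family of objects of `V` on which the
morphism objects act from the right. -/
structure EnrichedModule (V : Type u) [Category.{v} V] [MonoidalCategory V] (ι : Type w)
    [EnrichedCategory V ι] where
  /-- The underlying family of objects. -/
  X : ι → V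
  /-- The action of the morphism objects. -/
  act (i j : ι) : X i ⊗ (i ⟶[V] j) ⟶ X j
  act_id (i : ι) : X i ◁ eId V i ≫ act i i = (ρ_ (X i)).hom
  act_comp (i j k : ι) :
    act i j ▷ (j ⟶[V] k) ≫ act j k = (α_ _ _ _).hom ≫ X i ◁ eComp V i j k ≫ act i k

namespace EnrichedModule

variable {V : Type u} [Category.{v} V] [MonoidalCategory V] {ι : Type w} [EnrichedCategory V ι]

/-- A morphism of modules over an enriched category. -/
@[ext]
structure Hom (M N : EnrichedModule V ι) where
  /-- The underlying family of morphisms. -/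
  hom (i : ι) : M.X i ⟶ N.X i
  act_hom (i j : ι) : M.act i j ≫ hom j = hom i ▷ (i ⟶[V] j) ≫ N.act i j

instance : Category (EnrichedModule V ι) where
  Hom M N := Hom M N
  id M := { hom := fun i ↦ 𝟙 (M.X i), act_hom := by simp }
  comp f g :=
    { hom := fun i ↦ f.hom i ≫ g.hom i
      act_hom := fun i j ↦ by
        rw [← Category.assoc, f.act_hom, Category.assoc, g.act_hom, comp_whiskerRight,
          Category.assoc] }

@[ext]
theorem hom_ext {M N : EnrichedModule V ι} {f g : M ⟶ N} (h : ∀ i, f.hom i = g.hom i) : f = g :=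
  Hom.ext (funext h)

@[simp]
theorem id_hom (M : EnrichedModule V ι) (i : ι) : Hom.hom (𝟙 M) i = 𝟙 (M.X i) := rfl

@[simp]
theorem comp_hom {M N K : EnrichedModule V ι} (f : M ⟶ N) (g : N ⟶ K) (i : ι) :
    (f ≫ g).hom i = f.hom i ≫ g.hom i := rfl

/-- An isomorphism of modules from a compatible family of isomorphisms. -/
def mkIso {M N : EnrichedModule V ι} (e : ∀ i, M.X i ≅ N.X i)
    (h : ∀ i j, M.act i j ≫ (e j).hom = (e i).hom ▷ (i ⟶[V] j) ≫ N.act i j) : M ≅ N where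
  hom := { hom := fun i ↦ (e i).hom, act_hom := h }
  inv :=
    { hom := fun i ↦ (e i).inv
      act_hom := fun i j ↦ by
        rw [Iso.comp_inv_eq, Category.assoc, h, ← comp_whiskerRight_assoc, (e i).inv_hom_id,
          id_whiskerRight, Category.id_comp] }
  hom_inv_id := hom_ext fun i ↦ (e i).hom_inv_id
  inv_hom_id := hom_ext fun i ↦ (e i).inv_hom_id

@[simp]
theorem mkIso_hom_hom {M N : EnrichedModule V ι} (e : ∀ i, M.X i ≅ N.X i)
    (h : ∀ i j, M.act i j ≫ (e j).hom = (e i).hom ▷ (i ⟶[V] j) ≫ N.act i j) (i : ι) :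
    (mkIso e h).hom.hom i = (e i).hom := rfl

@[simp]
theorem mkIso_inv_hom {M N : EnrichedModule V ι} (e : ∀ i, M.X i ≅ N.X i)
    (h : ∀ i j, M.act i j ≫ (e j).hom = (e i).hom ▷ (i ⟶[V] j) ≫ N.act i j) (i : ι) :
    (mkIso e h).inv.hom i = (e i).inv := rfl

/-- The module `Y ⊗ M`. -/
abbrev tensorObj (Y : V) (M : EnrichedModule V ι) : EnrichedModule V ι where
  X i := Y ⊗ M.X i
  act i j := (α_ Y (M.X i) (i ⟶[V] j)).hom ≫ Y ◁ M.act i j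
  act_id i := by
    simp [← whiskerLeft_comp, M.act_id]
  act_comp i j k := by
    have h := congrArg (fun f => Y ◁ f) (M.act_comp i j k)
    simp only [whiskerLeft_comp] at h
    simp [h]

instance : MonoidalLeftAction V (EnrichedModule V ι) where
  actionObj Y M := tensorObj Y M
  actionHomLeft f M :=
    { hom := fun i ↦ f ▷ M.X i
      act_hom := by simp [whisker_exchange] }
  actionHomRight Y _ _ g :=
    { hom := fun i ↦ Y ◁ g.hom i
      act_hom := fun i j ↦ by
        have h := congrArg (fun f => Y ◁ f) (g.act_hom i j)
        simp only [whiskerLeft_comp] at h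
        simp [h] }
  actionAssocIso Y Z M := mkIso (fun i ↦ α_ Y Z (M.X i)) (by simp)
  actionUnitIso M := mkIso (fun i ↦ λ_ (M.X i)) (by simp)
  actionHom_comp f₁ f₂ g₁ g₂ := by
    apply hom_ext
    simp [whisker_exchange_assoc]
  actionAssocIso_hom_naturality f g h := by
    apply hom_ext
    simp [MonoidalCategory.tensorHom_def]
  actionUnitIso_hom_naturality f := by
    apply hom_ext
    simp

variable (V) in
/-- The value of a module at `i`, as a right module over the endomorphism algebra of `i`. -/
abbrev evalObj (i : ι) (M : EnrichedModule V ι) : RightMod (endMon V i) where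
  X := M.X i
  act := M.act i i
  act_one := M.act_id i
  act_mul := M.act_comp i i i

variable (V) in
/-- Evaluation at `i` of modules over an enriched category. -/
def eval (i : ι) : EnrichedModule V ι ⥤ RightMod (endMon V i) where
  obj M := evalObj V i M
  map f :=
    { hom := f.hom i
      act_hom := f.act_hom i i }

variable (V) in
/-- Evaluation at an object is left-linear. -/
@[reducible]
def leftLinearEval (i : ι) : (eval V i).LeftLinear V :=
  leftLinearOfIso _ (fun Y M ↦ RightMod.mkIso (Iso.refl (Y ⊗ M.X i)) (by
      change ((α_ Y (M.X i) (i ⟶[V] i)).hom ≫ Y ◁ M.act i i) ≫ 𝟙 _ =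
        𝟙 (Y ⊗ M.X i) ▷ (i ⟶[V] i) ≫ (α_ Y (M.X i) (i ⟶[V] i)).hom ≫ Y ◁ M.act i i
      simp))
    (fun {Y Z} g M ↦ by
      apply RightMod.hom_ext
      change g ▷ M.X i ≫ 𝟙 (Z ⊗ M.X i) = 𝟙 (Y ⊗ M.X i) ≫ g ▷ M.X i
      simp)
    (fun Y M N g ↦ by
      apply RightMod.hom_ext
      change Y ◁ g.hom i ≫ 𝟙 (Y ⊗ N.X i) = 𝟙 (Y ⊗ M.X i) ≫ Y ◁ g.hom i
      simp)
    (fun Y Z M ↦ by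
      apply RightMod.hom_ext
      change 𝟙 ((Y ⊗ Z) ⊗ M.X i) ≫ (α_ Y Z (M.X i)).hom =
        (α_ Y Z (M.X i)).hom ≫ Y ◁ 𝟙 (Z ⊗ M.X i) ≫ 𝟙 (Y ⊗ Z ⊗ M.X i)
      simp)
    (fun M ↦ by
      apply RightMod.hom_ext
      change (λ_ (M.X i)).hom = 𝟙 (𝟙_ V ⊗ M.X i) ≫ (λ_ (M.X i)).hom
      simp)

open Limits

/-! ### Evaluation is fully faithful -/

section FullyFaithful

variable [IsRegularEpiCategory V]
  [∀ X : V, PreservesColimitsOfShape WalkingParallelPair (tensorLeft X)]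

/-- Acting further by `i ⟶[V] j` shows that `u` and `v` agree on composites `j → i → j`. These cover
`j ⟶[V] j`, which contains the identity. -/
theorem eq_of_act_eq {i j : ι} [Epi (eComp V j i j)] (N : EnrichedModule V ι) {R : V}
    (u v : R ⟶ N.X j)
    (h : u ▷ (j ⟶[V] i) ≫ N.act j i = v ▷ (j ⟶[V] i) ≫ N.act j i) : u = v := by
  have hw (u : R ⟶ N.X j) : R ◁ eComp V j i j ≫ u ▷ (j ⟶[V] j) ≫ N.act j j =
      (α_ _ _ _).inv ≫ (u ▷ (j ⟶[V] i) ≫ N.act j i) ▷ (i ⟶[V] j) ≫ N.act i j := by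
    rw [comp_whiskerRight, Category.assoc, act_comp, whisker_exchange_assoc]
    simp
  have : Epi (R ◁ eComp V j i j) := epi_whiskerLeft _ _
  have hact : u ▷ (j ⟶[V] j) ≫ N.act j j = v ▷ (j ⟶[V] j) ≫ N.act j j := by
    rw [← cancel_epi (R ◁ eComp V j i j), hw, hw, h]
  have hunit (u : R ⟶ N.X j) :
      R ◁ eId V j ≫ u ▷ (j ⟶[V] j) ≫ N.act j j = (ρ_ R).hom ≫ u := by
    rw [whisker_exchange_assoc, act_id, rightUnitor_naturality]
  rw [← cancel_epi (ρ_ R).hom, ← hunit, ← hunit, hact]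

/-- The action of `j ⟶[V] j` is epimorphic thanks to the identity, and along the composites `j → i →
j` it factors through `N.act i j`. -/
theorem epi_act (i j : ι) [Epi (eComp V j i j)] (N : EnrichedModule V ι) : Epi (N.act i j) := by
  have : Epi (N.X j ◁ eComp V j i j) := epi_whiskerLeft _ _
  have : Epi (N.act j j) := epi_of_epi_fac (N.act_id j)
  have h : ((α_ _ _ _).inv ≫ N.act j i ▷ (i ⟶[V] j)) ≫ N.act i j =
      N.X j ◁ eComp V j i j ≫ N.act j j := by
    rw [Category.assoc, act_comp, Iso.inv_hom_id_assoc]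
  exact epi_of_epi_fac h

theorem eval_faithful (i : ι) [∀ j, Epi (eComp V j i j)] : (eval V i).Faithful where
  map_injective {M N f g} h := by
    have h' : f.hom i = g.hom i :=
      congrArg (fun k : evalObj V i M ⟶ evalObj V i N ↦ RightMod.Hom.hom k) h
    apply hom_ext
    intro j
    have := epi_act i j M
    rw [← cancel_epi (M.act i j), f.act_hom, g.act_hom, h']

variable [∀ X : V, PreservesColimitsOfShape WalkingParallelPair (tensorRight X)]

/-- The component at `j` is forced by linearity along the epimorphism `M.act i j`. It is well
defined because `eq_of_act_eq` moves the test back to `i`, where `g` is linear. -/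
theorem exists_hom_of_hom_eval (i : ι) [∀ j, Epi (eComp V j i j)] (M N : EnrichedModule V ι)
    (g : M.X i ⟶ N.X i) (hg : M.act i i ≫ g = g ▷ (i ⟶[V] i) ≫ N.act i i) :
    ∃ f : M ⟶ N, f.hom i = g := by
  have (j : ι) : Epi (M.act i j) := epi_act i j M
  have hdesc (j : ι) : ∃ l : M.X j ⟶ N.X j, M.act i j ≫ l = g ▷ (i ⟶[V] j) ≫ N.act i j := by
    refine exists_desc_of_epi _ _ fun {W} a b h ↦ eq_of_act_eq (i := i) N _ _ ?_
    have hw (a : W ⟶ M.X i ⊗ (i ⟶[V] j)) :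
        (a ≫ g ▷ (i ⟶[V] j) ≫ N.act i j) ▷ (j ⟶[V] i) ≫ N.act j i =
          (a ≫ M.act i j) ▷ (j ⟶[V] i) ≫ M.act j i ≫ g := by
      simp only [comp_whiskerRight, Category.assoc, act_comp, reassoc_of% @act_comp, hg]
      simp [whisker_exchange_assoc]
    rw [hw, hw, h]
  choose l hl using hdesc
  refine ⟨{ hom := l, act_hom := fun j k ↦ ?_ }, ?_⟩
  · have : Epi (M.act i j ▷ (j ⟶[V] k)) := epi_whiskerRight _ _
    rw [← cancel_epi (M.act i j ▷ (j ⟶[V] k)), reassoc_of% @act_comp, hl,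
      ← comp_whiskerRight_assoc, hl, comp_whiskerRight, Category.assoc, act_comp]
    simp [whisker_exchange_assoc]
  · rw [← cancel_epi (M.act i i), hg]
    exact hl i

theorem eval_full (i : ι) [∀ j, Epi (eComp V j i j)] : (eval V i).Full where
  map_surjective {M N} g := by
    obtain ⟨f, hf⟩ := exists_hom_of_hom_eval i M N g.hom g.act_hom
    exact ⟨f, RightMod.hom_ext _ _ hf⟩

end FullyFaithful

/-! ### Extension of scalars and essential surjectivity -/

section EssSurj

variable [HasCoequalizers V] {i : ι} (M : RightMod (endMon V i))

/-- The extension of scalars of a module over the endomorphism algebra of `i` to the whole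
enriched category, on underlying objects. -/
noncomputable abbrev extendX (j : ι) : V :=
  coequalizer (M.act ▷ (i ⟶[V] j))
    ((α_ M.X (i ⟶[V] i) (i ⟶[V] j)).hom ≫ M.X ◁ eComp V i i j)

/-- The projection onto the extension of scalars. -/
noncomputable abbrev extendπ (j : ι) : M.X ⊗ (i ⟶[V] j) ⟶ extendX M j := coequalizer.π _ _

theorem extendπ_condition (j : ι) :
    M.act ▷ (i ⟶[V] j) ≫ extendπ M j =
      (α_ M.X (i ⟶[V] i) (i ⟶[V] j)).hom ≫ M.X ◁ eComp V i i j ≫ extendπ M j := by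
  rw [coequalizer.condition, Category.assoc]

variable [∀ X : V, PreservesColimitsOfShape WalkingParallelPair (tensorRight X)]

/-- By associativity, composing on the right commutes with the left action of the endomorphisms of
`i`, so it descends to the relative tensor product. -/
theorem exists_extendAct (j k : ι) : ∃ l : extendX M j ⊗ (j ⟶[V] k) ⟶ extendX M k,
    extendπ M j ▷ (j ⟶[V] k) ≫ l =
      (α_ M.X (i ⟶[V] j) (j ⟶[V] k)).hom ≫ M.X ◁ eComp V i j k ≫ extendπ M k := by
  refine exists_desc_whiskerRight _ _ _ _ ?_
  rw [associator_naturality_left_assoc, ← whisker_exchange_assoc, extendπ_condition,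
    comp_whiskerRight_assoc]
  have h := congrArg (fun f ↦ M.X ◁ f) (e_assoc' V i i j k)
  simp only [whiskerLeft_comp] at h
  simp only [whisker_assoc, Category.assoc, Iso.inv_hom_id_assoc, tensor_whiskerLeft]
  rw [← reassoc_of% h]
  simp

/-- The action on the extension of scalars. -/
noncomputable def extendAct (j k : ι) : extendX M j ⊗ (j ⟶[V] k) ⟶ extendX M k :=
  (exists_extendAct M j k).choose

theorem extendπ_extendAct (j k : ι) : extendπ M j ▷ (j ⟶[V] k) ≫ extendAct M j k =
    (α_ M.X (i ⟶[V] j) (j ⟶[V] k)).hom ≫ M.X ◁ eComp V i j k ≫ extendπ M k :=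
  (exists_extendAct M j k).choose_spec

/-- The extension of scalars of a module over the endomorphism algebra of `i` to the whole
enriched category. -/
noncomputable abbrev extend : EnrichedModule V ι where
  X j := extendX M j
  act j k := extendAct M j k
  act_id j := by
    have h' : (i ⟶[V] j) ◁ eId V j ≫ eComp V i j j = (ρ_ (i ⟶[V] j)).hom := by
      rw [← cancel_epi (ρ_ _).inv, e_comp_id, Iso.inv_hom_id]
    have : Epi (extendπ M j ▷ 𝟙_ V) := epi_whiskerRight_of_isRegularEpi _ _
    rw [← cancel_epi (extendπ M j ▷ 𝟙_ V), ← whisker_exchange_assoc, extendπ_extendAct,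
      rightUnitor_naturality, tensor_whiskerLeft]
    simp only [Category.assoc, Iso.inv_hom_id_assoc]
    rw [← whiskerLeft_comp_assoc, h']
    simp
  act_comp j k l := by
    have : Epi (extendπ M j ▷ (j ⟶[V] k)) := epi_whiskerRight_of_isRegularEpi _ _
    -- Epimorphisms are not assumed regular here, so both tensorings are applied to the coequalizer
    -- at once.
    have : Epi ((extendπ M j ▷ (j ⟶[V] k)) ▷ (k ⟶[V] l)) :=
      epi_map_of_isRegularEpi (tensorRight (j ⟶[V] k) ⋙ tensorRight (k ⟶[V] l)) _
    rw [← cancel_epi ((extendπ M j ▷ (j ⟶[V] k)) ▷ (k ⟶[V] l)), ← comp_whiskerRight_assoc,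
      extendπ_extendAct, associator_naturality_left_assoc, ← whisker_exchange_assoc,
      extendπ_extendAct, comp_whiskerRight_assoc, comp_whiskerRight_assoc, extendπ_extendAct]
    have h := congrArg (fun f ↦ M.X ◁ f) (e_assoc' V i j k l)
    simp only [whiskerLeft_comp] at h
    simp only [whisker_assoc, Category.assoc, Iso.inv_hom_id_assoc, tensor_whiskerLeft]
    rw [← reassoc_of% h]
    simp

/-- Extension of scalars followed by evaluation is the identity up to isomorphism. -/
noncomputable def evalExtendIso : evalObj V i (extend M) ≅ M :=
  have hM : M.act ▷ (i ⟶[V] i) ≫ M.act =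
      (α_ M.X (i ⟶[V] i) (i ⟶[V] i)).hom ≫ M.X ◁ eComp V i i i ≫ M.act := M.act_mul
  have hone : M.X ◁ eId V i ≫ M.act = (ρ_ M.X).hom := M.act_one
  have hid : (i ⟶[V] i) ◁ eId V i ≫ eComp V i i i = (ρ_ (i ⟶[V] i)).hom := by
      rw [← cancel_epi (ρ_ _).inv, e_comp_id, Iso.inv_hom_id]
  RightMod.mkIso
    { hom := coequalizer.desc M.act (by rw [Category.assoc]; exact hM)
      inv := (ρ_ M.X).inv ≫ M.X ◁ eId V i ≫ extendπ M i
      hom_inv_id := by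
        apply coequalizer.hom_ext
        rw [coequalizer.π_desc_assoc, rightUnitor_inv_naturality_assoc,
          ← whisker_exchange_assoc, extendπ_condition, tensor_whiskerLeft]
        simp only [Category.assoc, Iso.inv_hom_id_assoc]
        rw [← whiskerLeft_comp_assoc, hid]
        simp
      inv_hom_id := by
        rw [Category.assoc, Category.assoc, coequalizer.π_desc, hone, Iso.inv_hom_id] }
    (by
      have : Epi (extendπ M i ▷ (i ⟶[V] i)) := epi_whiskerRight_of_isRegularEpi _ _
      rw [← cancel_epi (extendπ M i ▷ (i ⟶[V] i))]
      change extendπ M i ▷ (i ⟶[V] i) ≫ extendAct M i i ≫ _ = extendπ M i ▷ (i ⟶[V] i) ≫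
        coequalizer.desc M.act _ ▷ (i ⟶[V] i) ≫ _
      rw [reassoc_of% @extendπ_extendAct, ← comp_whiskerRight_assoc, coequalizer.π_desc,
        hM])

theorem eval_essSurj : (eval V i).EssSurj where
  mem_essImage M := ⟨extend M, ⟨evalExtendIso M⟩⟩

end EssSurj

theorem eval_isEquivalence [HasCoequalizers V] [IsRegularEpiCategory V]
    [∀ X : V, PreservesColimitsOfShape WalkingParallelPair (tensorLeft X)]
    [∀ X : V, PreservesColimitsOfShape WalkingParallelPair (tensorRight X)]
    (i : ι) [∀ j, Epi (eComp V j i j)] : (eval V i).IsEquivalence where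
  faithful := eval_faithful i
  full := eval_full i
  essSurj := eval_essSurj

end EnrichedModule

open Limits in
/-- Endomorphism algebras in an enriched category whose compositions are epimorphic are Morita
equivalent. -/
theorem moritaEquivalent_endMon {V : Type u} [Category.{v} V] [MonoidalCategory V]
    [HasCoequalizers V] [IsRegularEpiCategory V]
    [∀ X : V, PreservesColimitsOfShape WalkingParallelPair (tensorLeft X)]
    [∀ X : V, PreservesColimitsOfShape WalkingParallelPair (tensorRight X)]
    {ι : Type w} [EnrichedCategory V ι] (h : ∀ i j : ι, Epi (eComp V j i j)) (i j : ι) :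
    MoritaEquivalent (endMon V i) (endMon V j) := by
  have := EnrichedModule.eval_isEquivalence (V := V) i
  have := EnrichedModule.eval_isEquivalence (V := V) j
  let := EnrichedModule.leftLinearEval V i
  let := EnrichedModule.leftLinearEval V j
  let := leftLinearInv (C := V) (EnrichedModule.eval V i)
  exact ⟨(EnrichedModule.eval V i).inv ⋙ EnrichedModule.eval V j, inferInstance,
    ⟨leftLinearComp _ _⟩⟩

end MoritaMonoidal
namespace MoritaMonoidal

open MonoidalLeftAction Functor.LaxLeftLinear Functor.OplaxLeftLinear

/-! ### Regular epimorphisms under equivalences -/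

section Equivalence

variable {C D : Type*} [Category* C] [Category* D]

theorem isRegularEpi_map_of_isEquivalence (F : C ⥤ D) [F.IsEquivalence] {X Y : C} (f : X ⟶ Y)
    [IsRegularEpi f] : IsRegularEpi (F.map f) :=
  ⟨⟨{ W := F.obj (IsRegularEpi.W f)
      left := F.map (IsRegularEpi.left f)
      right := F.map (IsRegularEpi.right f)
      w := by rw [← F.map_comp, IsRegularEpi.w, F.map_comp]
      isColimit := Limits.isColimitCoforkMapOfIsColimit F _ (IsRegularEpi.isColimit f) }⟩⟩

theorem isRegularEpi_of_map_of_isEquivalence (F : C ⥤ D) [F.IsEquivalence] {X Y : C} (f : X ⟶ Y)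
    [IsRegularEpi (F.map f)] : IsRegularEpi f :=
  have := isRegularEpi_map_of_isEquivalence F.inv (F.map f)
  ⟨⟨RegularEpi.ofArrowIso
    (Arrow.isoMk (F.asEquivalence.unitIso.symm.app X) (F.asEquivalence.unitIso.symm.app Y)
      (F.asEquivalence.unitIso.inv.naturality f).symm)
    (IsRegularEpi.getStruct (F.inv.map (F.map f)))⟩⟩

end Equivalence

/-! ### Free modules and regular epimorphisms of modules -/

namespace RightMod

variable {C : Type*} [Category* C] [MonoidalCategory C] {A : Mon C}

/-- The regular right module. -/
abbrev regular (A : Mon C) : RightMod A where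
  X := A.X
  act := MonObj.mul
  act_one := MonObj.mul_one A.X
  act_mul := MonObj.mul_assoc A.X

/-- The action of `A` on `M`, as a morphism of modules from a free module. -/
def actHom (M : RightMod A) : M.X ⊙ₗ regular A ⟶ M where
  hom := M.act
  act_hom := by
    change ((α_ M.X A.X A.X).hom ≫ M.X ◁ MonObj.mul) ≫ M.act = M.act ▷ A.X ≫ M.act
    rw [M.act_mul, Category.assoc]

theorem actHom_naturality {M N : RightMod A} (f : M ⟶ N) :
    f.hom ⊵ₗ regular A ≫ actHom N = actHom M ≫ f :=
  hom_ext _ _ f.act_hom.symm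

/-- The bar presentation `M ⊗ A ⊗ A ⇉ M ⊗ A ⟶ M` is split in `C` by the unit of `A`. The splitting
is not linear, but the maps it induces out of `M` are. -/
instance isRegularEpi_actHom (M : RightMod A) : IsRegularEpi (actHom M) := by
  have w : M.act ⊵ₗ regular A ≫ actHom M =
      ((αₗ M.X A.X (regular A)).hom ≫ M.X ⊴ₗ actHom (regular A)) ≫ actHom M := by
    apply hom_ext
    change M.act ▷ A.X ≫ M.act = ((α_ M.X A.X A.X).hom ≫ M.X ◁ MonObj.mul) ≫ M.act
    rw [M.act_mul, Category.assoc]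
  refine ⟨⟨{ W := _, left := _, right := _, w := w, isColimit := ?_ }⟩⟩
  refine Limits.Cofork.IsColimit.mk' _ fun s ↦ ?_
  let k : M.X ⊗ A.X ⟶ s.pt.X := s.π.hom
  have hk : ((α_ M.X A.X A.X).hom ≫ M.X ◁ MonObj.mul) ≫ k = k ▷ A.X ≫ s.pt.act := s.π.act_hom
  have hs : M.act ▷ A.X ≫ k = ((α_ M.X A.X A.X).hom ≫ M.X ◁ MonObj.mul) ≫ k :=
    congrArg (fun g ↦ Hom.hom g) s.condition
  let l : M.X ⟶ s.pt.X := (ρ_ M.X).inv ≫ M.X ◁ MonObj.one ≫ k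
  have hl : M.act ≫ l = k := by
    simp only [l]
    rw [rightUnitor_inv_naturality_assoc, ← whisker_exchange_assoc, hs, tensor_whiskerLeft]
    simp only [Category.assoc, Iso.inv_hom_id_assoc]
    rw [← whiskerLeft_comp_assoc, MonObj.mul_one]
    simp
  have hl' : l ▷ A.X ≫ s.pt.act = k := by
    simp only [l, comp_whiskerRight, Category.assoc]
    rw [← hk]
    simp only [whisker_assoc, Category.assoc, Iso.inv_hom_id_assoc]
    rw [← whiskerLeft_comp_assoc, MonObj.one_mul]
    simp
  refine ⟨⟨l, hl.trans hl'.symm⟩, hom_ext _ _ hl, fun {m} hm ↦ hom_ext _ _ ?_⟩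
  have hm' : M.act ≫ m.hom = k := congrArg (fun g ↦ Hom.hom g) hm
  change m.hom = l
  simp only [l]
  rw [← hm', ← Category.assoc (M.X ◁ _), M.act_one, Iso.inv_hom_id_assoc]

open Limits in
/-- A coequalizer in the category of modules is an epimorphism in the base category, provided
that tensoring with objects on the right preserves coequalizers. -/
theorem epi_hom_of_isRegularEpi [HasCoequalizers C]
    [∀ X : C, PreservesColimitsOfShape WalkingParallelPair (tensorRight X)]
    {M N : RightMod A} (h : M ⟶ N) [IsRegularEpi h] : Epi h.hom := by
  let a := IsRegularEpi.left h
  let b := IsRegularEpi.right h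
  let c : M.X ⟶ coequalizer a.hom b.hom := coequalizer.π a.hom b.hom
  obtain ⟨act, hact⟩ : ∃ act, c ▷ A.X ≫ act = M.act ≫ c := by
    refine exists_desc_whiskerRight A.X a.hom b.hom _ ?_
    rw [← reassoc_of% a.act_hom, ← reassoc_of% b.act_hom, coequalizer.condition]
  have : Epi (c ▷ A.X) := epi_whiskerRight_of_isRegularEpi _ _
  have : Epi (c ▷ A.X ▷ A.X) := epi_map_of_isRegularEpi (tensorRight A.X ⋙ tensorRight A.X) c
  have : Epi (c ▷ 𝟙_ C) := epi_whiskerRight_of_isRegularEpi _ _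
  -- The coequalizer taken in `C` is a module, so `h` factors as `p ≫ q` through it.
  let K : RightMod A :=
    { X := coequalizer a.hom b.hom
      act := act
      act_one := by
        rw [← cancel_epi (c ▷ 𝟙_ C), ← whisker_exchange_assoc, hact, ← Category.assoc, M.act_one,
          rightUnitor_naturality]
      act_mul := by
        rw [← cancel_epi (c ▷ A.X ▷ A.X), ← comp_whiskerRight_assoc, hact, comp_whiskerRight_assoc,
          hact, ← Category.assoc, M.act_mul, associator_naturality_left_assoc,
          ← whisker_exchange_assoc, hact, Category.assoc, Category.assoc] }
  let p : M ⟶ K := { hom := c, act_hom := hact.symm }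
  have hp : a ≫ p = b ≫ p := hom_ext _ _ (coequalizer.condition a.hom b.hom)
  let d : N ⟶ K := IsRegularEpi.desc h p hp
  have hd : h ≫ d = p := IsRegularEpi.fac h p hp
  let e : coequalizer a.hom b.hom ⟶ N.X :=
    coequalizer.desc h.hom (congrArg (fun g ↦ Hom.hom g) (IsRegularEpi.w h))
  have he : c ≫ e = h.hom := coequalizer.π_desc _ _
  let q : K ⟶ N :=
    { hom := e
      act_hom := by
        change act ≫ e = e ▷ A.X ≫ N.act
        rw [← cancel_epi (c ▷ A.X), reassoc_of% hact, he, ← comp_whiskerRight_assoc, he,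
          h.act_hom] }
  have hq : p ≫ q = h := hom_ext _ _ he
  have : Epi h := epi_of_isColimit_cofork (IsRegularEpi.isColimit h)
  -- The universal property of `h` splits `q`, so its underlying morphism `e` is an epimorphism.
  have hdq : d ≫ q = 𝟙 N := by
    rw [← cancel_epi h, reassoc_of% hd, hq, Category.comp_id]
  have hde : d.hom ≫ e = 𝟙 N.X := congrArg (fun g ↦ Hom.hom g) hdq
  have : Epi (d.hom ≫ e) := by rw [hde]; infer_instance
  have : Epi e := epi_of_epi d.hom e
  rw [← he]
  exact epi_comp c e

end RightMod

/-! ### The generator and its evaluation morphism -/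

section Generator

open RightMod

variable {C D : Type*} [Category* C] [MonoidalCategory C] [Category* D] {A : Mon C}
  (F : D ⥤ RightMod A)

section

variable [F.IsEquivalence]

/-- The object corresponding to the regular module. -/
noncomputable def gen : D := F.objPreimage (regular A)

/-- The defining isomorphism of the object corresponding to the regular module. -/
noncomputable def genIso : F.obj (gen F) ≅ regular A := F.objObjPreimageIso (regular A)

/-- The unit element of `F (gen F)`. -/
noncomputable def genUnit : 𝟙_ C ⟶ (F.obj (gen F)).X := MonObj.one (X := A.X) ≫ (genIso F).inv.hom

theorem genIso_inv_hom_act : (genIso F).inv.hom ▷ A.X ≫ (F.obj (gen F)).act =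
    MonObj.mul (X := A.X) ≫ (genIso F).inv.hom :=
  (genIso F).inv.act_hom.symm

theorem genIso_hom_hom_inv_hom : (genIso F).hom.hom ≫ (genIso F).inv.hom = 𝟙 _ :=
  congrArg (fun g ↦ Hom.hom g) (genIso F).hom_inv_id

theorem genIso_inv_hom_hom_hom : (genIso F).inv.hom ≫ (genIso F).hom.hom = 𝟙 A.X :=
  congrArg (fun g ↦ Hom.hom g) (genIso F).inv_hom_id

end

variable [MonoidalLeftAction C D] [F.LeftLinear C]

/-- The lineator of a functor to modules, as a morphism of the base category. -/
def lin (Y : C) (M : D) : Y ⊗ (F.obj M).X ⟶ (F.obj (Y ⊙ₗ M)).X := (μₗ F Y M).hom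

theorem lin_naturality_left {Y Z : C} (f : Y ⟶ Z) (M : D) :
    f ▷ (F.obj M).X ≫ lin F Z M = lin F Y M ≫ (F.map (f ⊵ₗ M)).hom :=
  congrArg (fun g ↦ Hom.hom g) (μₗ_naturality_left F f M)

theorem lin_naturality_right (Y : C) {M N : D} (f : M ⟶ N) :
    Y ◁ (F.map f).hom ≫ lin F Y N = lin F Y M ≫ (F.map (Y ⊴ₗ f)).hom :=
  congrArg (fun g ↦ Hom.hom g) (μₗ_naturality_right F Y f)

theorem lin_associativity (Y Z : C) (M : D) :
    lin F (Y ⊗ Z) M ≫ (F.map (αₗ Y Z M).hom).hom =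
      (α_ Y Z (F.obj M).X).hom ≫ Y ◁ lin F Z M ≫ lin F Y (Z ⊙ₗ M) :=
  congrArg (fun g ↦ Hom.hom g) (μₗ_associativity F Y Z M)

theorem lin_unitality (M : D) :
    lin F (𝟙_ C) M ≫ (F.map (λₗ[C] M).hom).hom = (λ_ (F.obj M).X).hom :=
  congrArg (fun g ↦ Hom.hom g) (μₗ_unitality F M).symm

instance (Y : C) (M : D) : IsIso (lin F Y M) :=
  inferInstanceAs (IsIso ((RightMod.forget A).map (μₗ F Y M)))

variable [F.IsEquivalence]

/-- The evaluation morphism `(F M) ⊙ₗ gen F ⟶ M`. -/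
noncomputable def ev (M : D) : (F.obj M).X ⊙ₗ gen F ⟶ M :=
  F.preimage (δₗ F _ _ ≫ (F.obj M).X ⊴ₗ (genIso F).hom ≫ actHom (F.obj M))

theorem map_ev (M : D) : F.map (ev F M) =
    δₗ F _ _ ≫ (F.obj M).X ⊴ₗ (genIso F).hom ≫ actHom (F.obj M) :=
  F.map_preimage _

theorem lineator_map_ev (M : D) : μₗ F _ _ ≫ F.map (ev F M) =
    (F.obj M).X ⊴ₗ (genIso F).hom ≫ actHom (F.obj M) := by
  rw [map_ev, Functor.LeftLinear.μₗ_comp_δₗ_assoc]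

theorem lin_map_ev (M : D) : lin F _ _ ≫ (F.map (ev F M)).hom =
    (F.obj M).X ◁ (genIso F).hom.hom ≫ (F.obj M).act :=
  congrArg (fun g ↦ Hom.hom g) (lineator_map_ev F M)

theorem ev_naturality {M N : D} (f : M ⟶ N) :
    (F.map f).hom ⊵ₗ gen F ≫ ev F N = ev F M ≫ f := by
  apply F.map_injective
  rw [← cancel_epi (μₗ F _ _), F.map_comp, F.map_comp, ← μₗ_naturality_left_assoc,
    lineator_map_ev, reassoc_of% @lineator_map_ev, ← action_exchange_assoc, actHom_naturality]

/-- The lineator is itself a module morphism, so the action is natural with respect to it. This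
feeds the associativity of composition. -/
theorem ev_linear (Y : C) (M : D) :
    lin F Y M ⊵ₗ gen F ≫ ev F (Y ⊙ₗ M) =
      (αₗ Y (F.obj M).X (gen F)).hom ≫ Y ⊴ₗ ev F M := by
  apply F.map_injective
  rw [← cancel_epi (μₗ F _ _), F.map_comp, F.map_comp, ← μₗ_naturality_left_assoc,
    lineator_map_ev, μₗ_associativity_assoc, ← μₗ_naturality_right, ← actionHomRight_comp_assoc,
    lineator_map_ev, ← action_exchange_assoc]
  have h : lin F Y M ⊵ₗ regular A ≫ actHom (F.obj (Y ⊙ₗ M)) =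
      ((αₗ Y (F.obj M).X (regular A)).hom ≫ Y ⊴ₗ actHom (F.obj M)) ≫ μₗ F Y M :=
    actHom_naturality (μₗ F Y M)
  rw [h]
  simp

theorem genUnit_ev : genUnit F ⊵ₗ gen F ≫ ev F (gen F) = (λₗ[C] (gen F)).hom := by
  apply F.map_injective
  rw [← cancel_epi (μₗ F _ _), F.map_comp, ← μₗ_naturality_left_assoc,
    lineator_map_ev, ← μₗ_unitality]
  apply hom_ext
  change genUnit F ▷ (F.obj (gen F)).X ≫ (F.obj (gen F)).X ◁ (genIso F).hom.hom ≫
    (F.obj (gen F)).act = (λ_ (F.obj (gen F)).X).hom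
  rw [← whisker_exchange_assoc, genUnit, comp_whiskerRight, Category.assoc, genIso_inv_hom_act,
    MonObj.one_mul_assoc, leftUnitor_naturality_assoc, genIso_hom_hom_inv_hom, Category.comp_id]

theorem ev_genUnit (M : D) : (F.obj M).X ◁ genUnit F ≫ lin F _ _ ≫ (F.map (ev F M)).hom =
    (ρ_ (F.obj M).X).hom := by
  rw [lin_map_ev, ← whiskerLeft_comp_assoc, genUnit, Category.assoc, genIso_inv_hom_hom_hom,
    Category.comp_id, act_one]

/-- Up to isomorphism, `F` sends `ev F M` to the free presentation `actHom (F.obj M)`. -/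
theorem isRegularEpi_ev (M : D) : IsRegularEpi (ev F M) := by
  have : IsRegularEpi (F.map (ev F M)) := by
    rw [map_ev, ← Category.assoc]
    exact (MorphismProperty.cancel_left_of_respectsIso
      (MorphismProperty.regularEpi _) _ _).2 (isRegularEpi_actHom _)
  exact isRegularEpi_of_map_of_isEquivalence F _

end Generator

/-! ### From linear equivalences to an enriched category -/

section Family

open RightMod

variable {C D ι : Type*} [Category* C] [MonoidalCategory C] [Category* D] [MonoidalLeftAction C D]
  {A : ι → Mon C} (F : ∀ i, D ⥤ RightMod (A i)) [∀ i, (F i).LeftLinear C]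
  [∀ i, (F i).IsEquivalence]

/-- A family of left-linear equivalences from a module category `D` to categories of right modules
makes the index set into a category enriched in `C`: the morphism object from `i` to `j` is the
object of morphisms of `D` between the generators corresponding to `j` and `i`. -/
@[reducible]
noncomputable def enrichedCategoryOfFamily : EnrichedCategory C ι where
  Hom i j := ((F j).obj (gen (F i))).X
  id i := genUnit (F i)
  comp i j k := lin (F k) ((F j).obj (gen (F i))).X (gen (F j)) ≫
    ((F k).map (ev (F j) (gen (F i)))).hom
  id_comp i j := by
    rw [reassoc_of% @lin_naturality_left, ← comp_hom, ← (F j).map_comp, genUnit_ev,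
      lin_unitality, Iso.inv_hom_id]
  comp_id i j := by
    rw [ev_genUnit, Iso.inv_hom_id]
  assoc w x y z := by
    rw [reassoc_of% @lin_naturality_left, ← comp_hom, ← (F z).map_comp,
      comp_actionHomLeft_assoc, ev_naturality, reassoc_of% @ev_linear, (F z).map_comp, comp_hom,
      reassoc_of% @lin_associativity, Iso.inv_hom_id_assoc, (F z).map_comp, comp_hom,
      ← reassoc_of% @lin_naturality_right,
      whiskerLeft_comp_assoc]

open Limits in
theorem epi_comp_enrichedCategoryOfFamily [HasCoequalizers C]
    [∀ X : C, PreservesColimitsOfShape WalkingParallelPair (tensorRight X)] (i j k : ι) :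
    Epi ((enrichedCategoryOfFamily F).comp i j k) := by
  have := isRegularEpi_ev (F j) (gen (F i))
  have := isRegularEpi_map_of_isEquivalence (F k) (ev (F j) (gen (F i)))
  have := epi_hom_of_isRegularEpi ((F k).map (ev (F j) (gen (F i))))
  exact epi_comp _ _

/-- The endomorphism algebra of `i` in the enriched category attached to a family of left-linear
equivalences is the `i`-th algebra. -/
noncomputable def endMonIso (i : ι) :
    letI := enrichedCategoryOfFamily F
    A i ≅ endMon C i :=
  letI := enrichedCategoryOfFamily F
  Mon.mkIso (M := A i) (N := endMon C i)
    ((RightMod.forget (A i)).mapIso (genIso (F i)).symm) rfl (by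
      change MonObj.mul ≫ (genIso (F i)).inv.hom =
        ((genIso (F i)).inv.hom ⊗ₘ (genIso (F i)).inv.hom) ≫ lin (F i) _ _ ≫
          ((F i).map (ev (F i) (gen (F i)))).hom
      rw [lin_map_ev, tensorHom_def_assoc, ← whiskerLeft_comp_assoc, genIso_inv_hom_hom_hom,
        whiskerLeft_id, Category.id_comp, genIso_inv_hom_act])

end Family

section

variable {C : Type*} [Category* C] [MonoidalCategory C] {A B : Mon C}

/-- Two algebras, as a family. -/
def algPair (A B : Mon C) : Bool → Mon C
  | true => A
  | false => B

/-- The identity functor of the category of modules over `A` and a functor out of it, as a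
family. -/
def idPairFunctor (F : RightMod A ⥤ RightMod B) (b : Bool) :
    RightMod A ⥤ RightMod (algPair A B b) :=
  match b with
  | true => 𝟭 (RightMod A)
  | false => F

end

open Limits in
/-- Morita equivalent algebras are endomorphism algebras in an enriched category with two
objects whose compositions are epimorphisms. -/
theorem MoritaEquivalent.exists_enrichedCategory {C : Type*} [Category* C] [MonoidalCategory C]
    [HasCoequalizers C] [∀ X : C, PreservesColimitsOfShape WalkingParallelPair (tensorRight X)]
    {A B : Mon C} (h : MoritaEquivalent A B) :
    ∃ _ : EnrichedCategory C Bool, Nonempty (A ≅ endMon C true) ∧ Nonempty (B ≅ endMon C false) ∧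
      ∀ i j k : Bool, Epi (eComp C i j k) := by
  obtain ⟨F, _, ⟨_⟩⟩ := h
  let (b : Bool) : (idPairFunctor F b).LeftLinear C :=
    match b with
    | true => leftLinearId
    | false => inferInstanceAs (F.LeftLinear C)
  have (b : Bool) : (idPairFunctor F b).IsEquivalence :=
    match b with
    | true => inferInstanceAs (𝟭 (RightMod A)).IsEquivalence
    | false => inferInstanceAs F.IsEquivalence
  exact ⟨enrichedCategoryOfFamily (idPairFunctor F), ⟨endMonIso (idPairFunctor F) true⟩,
    ⟨endMonIso (idPairFunctor F) false⟩, epi_comp_enrichedCategoryOfFamily (idPairFunctor F)⟩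

end MoritaMonoidal

/-! ### Transport along the monoidal functor -/

open MoritaMonoidal in
theorem theorem4p1
    {S : Type*} [Category* S] [Abelian S] [MonoidalCategory S]
    [∀ X : S, Limits.PreservesColimitsOfShape Limits.WalkingParallelPair (tensorLeft X)]
    [∀ X : S, Limits.PreservesColimitsOfShape Limits.WalkingParallelPair (tensorRight X)]
    {T : Type*} [Category* T] [Abelian T] [MonoidalCategory T]
    [∀ X : T, Limits.PreservesColimitsOfShape Limits.WalkingParallelPair (tensorLeft X)]
    [∀ X : T, Limits.PreservesColimitsOfShape Limits.WalkingParallelPair (tensorRight X)]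
    (Γ : S ⥤ T) [Γ.LaxMonoidal] [Γ.PreservesEpimorphisms]
    (hΓ : ∀ X Y : S, Epi (Functor.LaxMonoidal.μ Γ X Y))
    (A B : Mon S) (hAB : MoritaMonoidal.MoritaEquivalent A B) :
    MoritaMonoidal.MoritaEquivalent (Γ.mapMon.obj A) (Γ.mapMon.obj B) := by
  obtain ⟨_, ⟨eA⟩, ⟨eB⟩, hepi⟩ := hAB.exists_enrichedCategory
  have hcomp (i j : Bool) : Epi (Functor.LaxMonoidal.μ Γ _ _ ≫ Γ.map (eComp S j i j)) :=
    have := hepi j i j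
    have := hΓ (j ⟶[S] i) (i ⟶[S] j)
    epi_comp _ _
  -- The endomorphism algebras of the transported enrichment are, by definition, the images under
  -- `Γ` of the original ones.
  have h : MoritaEquivalent (Γ.mapMon.obj (endMon S true)) (Γ.mapMon.obj (endMon S false)) :=
    moritaEquivalent_endMon (V := T) (ι := TransportEnrichment Γ Bool) hcomp true false
  exact (MoritaEquivalent.of_iso (Γ.mapMon.mapIso eA)).trans
    (h.trans (MoritaEquivalent.of_iso (Γ.mapMon.mapIso eB)).symm)
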